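/- **Conventions.** For a C*-algebra $\mathfrak A$, $\mathfrak{sa}(\mathfrak A)$ is its self-adjoint part, $\mathscr S(\mathfrak A)$ its state space, $\mathfrak{uA}$ the smallest unital C*-algebra containing $\mathfrak A$ (so $\mathfrak{uA}=\mathfrak A$ if $\mathfrak A$ is unital), and $a\circ b=\frac{ab+ba}{2}$, $\{a,b\}=\frac{ab-ba}{2i}$. A *Lipschitz triple* $(\mathfrak A,\mathsf L,\mathfrak M)$ consists of a C*-algebra $\mathfrak A$, a seminorm $\mathsf L$ on a dense real subspace of $\mathfrak{sa}(\mathfrak{uA})$ with $\{\mathsf L=0\}=\mathbb R1$ (set $\mathsf L=\infty$ off its domain), and an Abelian C*-subalgebra $\mathfrak M$ of $\mathfrak A$ (the topography) containing an approximate unit of $\mathfrak A$; $\mathfrak M^\sigma$ is the Gel'fand spectrum of $\mathfrak M$. Put $\mathsf{mk}_{\mathsf L}(\varphi,\psi)=\sup\{|\varphi(a)-\psi(a)|:a\in\mathfrak{sa}(\mathfrak A),\mathsf L(a)\le1\}$ on states of $\mathfrak A$, and let $\mathsf{mk}^\sigma_{\mathsf L}$ be the same expression with $a$ restricted to $\mathfrak{sa}(\mathfrak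 M)$, for states of $\mathfrak M$. For $K\subseteq\mathfrak M^\sigma$ compact let $1_K\in\mathfrak M^{**}\subseteq\mathfrak A^{**}$ be its indicator projection, and $$\mathfrak L_{\mathfrak A}[K]=\{a\in\mathfrak{sa}(\mathfrak A):1_Ka1_K=a,\ \mathsf L(a)<\infty\},\qquad \mathscr S[\mathfrak A|K]=\{\varphi\in\mathscr S(\mathfrak A):\varphi(1_K)=1\}.$$ Let $\mathfrak L_{\mathfrak A}[\star]$ be the union of the $\mathfrak L_{\mathfrak A}[K]$ over all compact $K$. A set $S$ of states is *tame* if $\sup\{|\varphi(a-1_Ka1_K)|:\varphi\in S,a\in\mathfrak{sa}(\mathfrak A),\mathsf L(a)\le1\}\to0$ as $K$ increases through the compact subsets of $\mathfrak M^\sigma$. The triple is a *quantum locally compact metric space* if $\mathsf{mk}_{\mathsf L}$ metrizes the weak* topology on every tame set of states. It is a *proper quantum metric space* if moreover: $\mathfrak A$ is separable; $\mathsf L(a\circ b)$ and $\mathsf L(\{a,b\})$ are at most $\|a\|\mathsf L(b)+\mathsf L(a)\|b\|$ for $a,b\in\mathfrak{sa}(\mathfrak A)$; $\mathsf L$ is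 norm lower semicontinuous on $\mathfrak{sa}(\mathfrak A)$; $\mathfrak L_{\mathfrak A}[\star]$ is norm dense in $\{a\in\mathfrak{sa}(\mathfrak A):\mathsf L(a)<\infty\}$; $\mathfrak L_{\mathfrak A}[\star]\cap\mathfrak M$ is dense in $\mathfrak{sa}(\mathfrak M)$; and $(\mathfrak M^\sigma,\mathsf{mk}^\sigma_{\mathsf L})$ is a proper metric space. It is *pointed* by a choice of $\mu\in\mathfrak M^\sigma$; then $\mathfrak L_{\mathfrak A}[\mu,r]$ and $\mathscr S[\mathfrak A|\mu,r]$ denote $\mathfrak L_{\mathfrak A}[K]$ and $\mathscr S[\mathfrak A|K]$ for $K$ the closed $\mathsf{mk}^\sigma_{\mathsf L}$-ball of centre $\mu$ and radius $r$. A *passage* $\tau$ from $(\mathfrak A,\mathsf L_{\mathfrak A},\mathfrak M_{\mathfrak A},\mu_{\mathfrak A})$ to $(\mathfrak B,\mathsf L_{\mathfrak B},\mathfrak M_{\mathfrak B},\mu_{\mathfrak B})$, both pointed proper quantum metric spaces, is a quantum locally compact metric space $(\mathfrak D,\mathsf L_{\mathfrak D},\mathfrak M_{\mathfrak D})$ with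 $\mathsf L_{\mathfrak D}$ norm lower semicontinuous on $\mathfrak{sa}(\mathfrak D)$, and surjective *-morphisms $\pi_{\mathfrak A}:\mathfrak D\to\mathfrak A$, $\pi_{\mathfrak B}:\mathfrak D\to\mathfrak B$ which map $\mathfrak M_{\mathfrak D}$ into $\mathfrak M_{\mathfrak A}$, resp. $\mathfrak M_{\mathfrak B}$, and some approximate unit of $\mathfrak D$ in $\mathfrak M_{\mathfrak D}$ to an approximate unit. Its inverse $\tau^{-1}$ exchanges $\mathfrak A$ and $\mathfrak B$. For $a\in\mathfrak{sa}(\mathfrak A)$, $l\ge0$, $r,\varepsilon>0$ and $K\subseteq\mathfrak M_{\mathfrak D}^\sigma$ compact, the *lift set* and *target set* of $a$ are $$\mathfrak l_\tau(a|l,r,\varepsilon,K)=\{d\in\mathfrak L_{\mathfrak D}[K]:\pi_{\mathfrak A}(d)=a,\ \pi_{\mathfrak B}(d)\in\mathfrak L_{\mathfrak B}[\mu_{\mathfrak B},r+4\varepsilon],\ \mathsf L_{\mathfrak D}(d)\le l\},\qquad \mathfrak t_\tau(a|l,r,\varepsilon,K)=\pi_{\mathfrak B}\big(\mathfrak l_\tau(a|l,r,\varepsilon,K)\big).$$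 The pair $(\varepsilon,K)$ is *$r$-left admissible* for $\tau$ if: (i) $\psi\circ\pi_{\mathfrak A}\in\mathscr S[\mathfrak D|K]$ for all $\psi\in\mathscr S[\mathfrak A|\mu_{\mathfrak A},r]$; (ii) for every $\varphi\in\mathscr S[\mathfrak D|K]$ there is $\psi\in\mathscr S[\mathfrak A|\mu_{\mathfrak A},r+4\varepsilon]$ with $\mathsf{mk}_{\mathsf L_{\mathfrak D}}(\varphi,\psi\circ\pi_{\mathfrak A})\le\varepsilon$; (iii) $\mathfrak t_\tau(a|\mathsf L_{\mathfrak A}(a),r,\varepsilon,K)\ne\emptyset$ for all $a\in\mathfrak L_{\mathfrak A}[\mu_{\mathfrak A},r]$, and (iv) it meets $\mathfrak M_{\mathfrak B}$ if moreover $a\in\mathfrak M_{\mathfrak A}$; (v) $\mathsf L_{\mathfrak B}(\pi_{\mathfrak B}(d))\le\mathsf L_{\mathfrak D}(d)$ for all $d\in\mathfrak L_{\mathfrak D}[K]$. It is *$r$-admissible* for $\tau$ if it is $r$-left admissible for both $\tau$ and $\tau^{-1}$, $\mathsf{mk}^\sigma_{\mathsf L_{\mathfrak D}}(\mu_{\mathfrak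 A}\circ\pi_{\mathfrak A},\mu_{\mathfrak B}\circ\pi_{\mathfrak B})\le\varepsilon$, and $\mathsf L_{\mathfrak D}(d\circ d')$ and $\mathsf L_{\mathfrak D}(\{d,d'\})$ are at most $\mathsf L_{\mathfrak D}(d)\|d'\|+\mathsf L_{\mathfrak D}(d')\|d\|$ for all $d,d'\in\mathfrak L_{\mathfrak D}[K]$. The passage $\tau$ is an *$r$-tunnel* if there are $\varepsilon'>0$ and compact sets $K_t\subseteq\mathfrak M_{\mathfrak D}^\sigma$ ($0<t\le r$), increasing in $t$, with $(\varepsilon',K_t)$ $t$-admissible for every $t\in(0,r]$. **Theorem.** Let $r>0$, let $\tau$ be an $r$-tunnel from $(\mathfrak A,\mathsf L_{\mathfrak A},\mathfrak M_{\mathfrak A},\mu_{\mathfrak A})$ to $(\mathfrak B,\mathsf L_{\mathfrak B},\mathfrak M_{\mathfrak B},\mu_{\mathfrak B})$, let $l\ge0$, and let $(\varepsilon,K)$ be an $r$-admissible pair for $\tau$. Let $a,a'\in\mathfrak L_{\mathfrak A}[\mu_{\mathfrak A},r]$ with $\mathsf L_{\mathfrak A}(a)\le l$ and $\mathsf L_{\mathfrak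 A}(a')\le l$. Then: 1. $\|d\|_{\mathfrak D}\le\|a\|_{\mathfrak A}+l\varepsilon$ for all $d\in\mathfrak l_\tau(a|l,r,\varepsilon,K)$, and $\|b\|_{\mathfrak B}\le\|a\|_{\mathfrak A}+l\varepsilon$ for all $b\in\mathfrak t_\tau(a|l,r,\varepsilon,K)$. 2. For all $b\in\mathfrak t_\tau(a|l,r,\varepsilon,K)$, $b'\in\mathfrak t_\tau(a'|l,r,\varepsilon,K)$ and $t\in\mathbb R$: $\;b+tb'\in\mathfrak t_\tau(a+ta'|(1+|t|)l,r,\varepsilon,K)$. 3. $\sup\{\|b-b'\|_{\mathfrak B}:b\in\mathfrak t_\tau(a|l,r,\varepsilon,K),\ b'\in\mathfrak t_\tau(a'|l,r,\varepsilon,K)\}\le\|a-a'\|_{\mathfrak A}+2l\varepsilon$; in particular the norm diameter of $\mathfrak t_\tau(a|l,r,\varepsilon,K)$ is at most $2l\varepsilon$. 4. For all $b\in\mathfrak t_\tau(a|l,r,\varepsilon,K)$ and $b'\in\mathfrak t_\tau(a'|l,r,\varepsilon,K)$: $$b\circ b'\in\mathfrak t_\tau\big(a\circ a'\,\big|\,l(\|a\|_{\mathfrak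 A}+\|a'\|_{\mathfrak A}+2l\varepsilon),r,\varepsilon,K\big),\qquad \{b,b'\}\in\mathfrak t_\tau\big(\{a,a'\}\,\big|\,l(\|a\|_{\mathfrak A}+\|a'\|_{\mathfrak A}+2l\varepsilon),r,\varepsilon,K\big).$$ -/

import Mathlib

open Filter Topology
open scoped ENNReal MultiplierAlgebra

noncomputable section

/-! ### States, the bidual, and indicators of compact subsets of the topography -/

/-- The state space of a C⋆-algebra: positive linear functionals of norm one. -/
def stateSpace (A : Type*) [NonUnitalCStarAlgebra A] : Set (StrongDual ℂ A) :=
  {φ | ‖φ‖ = 1 ∧ ∀ a : A, 0 ≤ (φ (star a * a)).re ∧ (φ (star a * a)).im = 0}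

/-- The bidual `A**`. -/
abbrev Bidual (A : Type*) [NonUnitalCStarAlgebra A] : Type _ :=
  StrongDual ℂ (StrongDual ℂ A)

/-- The canonical embedding of `A` in `A**`. -/
def toBidual {A : Type*} [NonUnitalCStarAlgebra A] (a : A) : Bidual A :=
  NormedSpace.inclusionInDoubleDual ℂ A a

/-- The functional `G · f : a ↦ G (b ↦ f (a * b))`, as a continuous linear function of `f`. -/
def bidualAct {A : Type*} [NonUnitalCStarAlgebra A] (G : Bidual A) :
    StrongDual ℂ A →L[ℂ] StrongDual ℂ A :=
  (ContinuousLinearMap.compL ℂ A (StrongDual ℂ A) ℂ G).comp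
    (((ContinuousLinearMap.compL ℂ A (A →L[ℂ] A) (StrongDual ℂ A)).flip
      (ContinuousLinearMap.mul ℂ A)).comp (ContinuousLinearMap.compL ℂ A A ℂ))

theorem bidualAct_apply {A : Type*} [NonUnitalCStarAlgebra A] (G : Bidual A)
    (f : StrongDual ℂ A) (a : A) :
    bidualAct G f a = G (f.comp (ContinuousLinearMap.mul ℂ A a)) := rfl

/-- The (Arens) product of the enveloping von Neumann algebra `A**`:
`(F G) f = F (a ↦ G (b ↦ f (a * b)))`. -/
def bidualMul {A : Type*} [NonUnitalCStarAlgebra A] (F G : Bidual A) : Bidual A :=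
  F.comp (bidualAct G)

/-- For a set `K` of characters of `M`, the elements `m` of `M` with `0 ≤ m ≤ 1` whose Gel'fand
transform is equal to `1` on `K`. For `K` compact, this set, ordered by the order of `A`, is
directed downward and its Gel'fand transforms decrease to the indicator function of `K`. -/
def indicatorNet {A : Type*} [NonUnitalCStarAlgebra A] [PartialOrder A]
    (M : NonUnitalStarSubalgebra ℂ A) (K : Set (WeakDual.characterSpace ℂ M)) : Set A :=
  {m | 0 ≤ m ∧ ‖m‖ ≤ 1 ∧ ∃ h : m ∈ M, ∀ χ ∈ K, χ ⟨m, h⟩ = 1}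

/-- A bounded functional is eventually almost constant along `indicatorNet M K`. -/
theorem indicatorNet_cauchy {A : Type*} [NonUnitalCStarAlgebra A] [PartialOrder A]
    [StarOrderedRing A] (M : NonUnitalStarSubalgebra ℂ A)
    (K : Set (WeakDual.characterSpace ℂ M)) (m₀ : indicatorNet M K) (f : StrongDual ℂ A)
    {ε : ℝ} (hε : 0 < ε) :
    ∃ m₁ : indicatorNet M K, ∀ m ≤ m₁, ‖f (m : A) - f (m₁ : A)‖ < ε := by
  by_contra! hcon
  choose next hle hbig using hcon
  let s : ℕ → indicatorNet M K := fun n => next^[n] m₀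
  have hs : ∀ n, s (n + 1) = next (s n) := fun n => Function.iterate_succ_apply' _ _ _
  let d : ℕ → A := fun n => (s n : A) - (s (n + 1) : A)
  have hd : ∀ n, 0 ≤ d n := fun n => by
    have h1 : s (n + 1) ≤ s n := by rw [hs]; exact hle _
    exact sub_nonneg.2 h1
  have hsum : ∀ N, ∑ i ∈ Finset.range N, d i ≤ (s 0 : A) := fun N => by
    rw [Finset.sum_range_sub']
    exact sub_le_self _ (s N).2.1
  have hfin : ∀ N, ∀ I ⊆ Finset.range N, ‖∑ i ∈ I, d i‖ ≤ 1 := fun N I hI => by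
    refine (CStarAlgebra.norm_le_norm_of_nonneg_of_le (Finset.sum_nonneg fun i _ => hd i)
      ((Finset.sum_le_sum_of_subset_of_nonneg hI fun i _ _ => hd i).trans (hsum N))).trans
      (s 0).2.2.1
  have hb : ∀ N, ∀ I ⊆ Finset.range N, ‖∑ i ∈ I, f (d i)‖ ≤ ‖f‖ := fun N I hI => by
    rw [← map_sum]
    refine (f.le_opNorm _).trans ?_
    calc ‖f‖ * ‖∑ i ∈ I, d i‖ ≤ ‖f‖ * 1 :=
          mul_le_mul_of_nonneg_left (hfin N I hI) (norm_nonneg _)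
      _ = ‖f‖ := mul_one _
  have habs : ∀ u : ℕ → ℝ, (∀ N, ∀ I ⊆ Finset.range N, |∑ i ∈ I, u i| ≤ ‖f‖) →
      ∀ N, ∑ i ∈ Finset.range N, |u i| ≤ 2 * ‖f‖ := fun u hu N => by
    rw [← Finset.sum_filter_add_sum_filter_not (Finset.range N) (fun i => 0 ≤ u i)]
    have h1 : ∑ i ∈ (Finset.range N).filter (fun i => 0 ≤ u i), |u i| ≤ ‖f‖ := by
      rw [Finset.sum_congr rfl fun i hi => abs_of_nonneg (Finset.mem_filter.1 hi).2]
      exact (le_abs_self _).trans (hu N _ (Finset.filter_subset _ _))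
    have h2 : ∑ i ∈ (Finset.range N).filter (fun i => ¬ 0 ≤ u i), |u i| ≤ ‖f‖ := by
      rw [Finset.sum_congr rfl fun i hi => abs_of_neg (not_le.1 (Finset.mem_filter.1 hi).2),
        Finset.sum_neg_distrib]
      exact (neg_le_abs _).trans (hu N _ (Finset.filter_subset _ _))
    linarith
  have hre := habs (fun i => (f (d i)).re) fun N I hI => by
    rw [← Complex.re_sum]
    exact (Complex.abs_re_le_norm _).trans (hb N I hI)
  have him := habs (fun i => (f (d i)).im) fun N I hI => by
    rw [← Complex.im_sum]
    exact (Complex.abs_im_le_norm _).trans (hb N I hI)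
  have hlow : ∀ N : ℕ, N * ε ≤ 4 * ‖f‖ := fun N => by
    have h1 : ∑ _i ∈ Finset.range N, ε ≤
        ∑ i ∈ Finset.range N, (|(f (d i)).re| + |(f (d i)).im|) := by
      refine Finset.sum_le_sum fun i _ => ?_
      refine le_trans ?_ (Complex.norm_le_abs_re_add_abs_im _)
      have h2 := hbig (s i)
      rw [← hs, norm_sub_rev, ← map_sub] at h2
      exact h2
    rw [Finset.sum_const, Finset.card_range, nsmul_eq_mul, Finset.sum_add_distrib] at h1
    linarith [hre N, him N]
  obtain ⟨N, hN⟩ := exists_nat_gt (4 * ‖f‖ / ε)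
  rw [div_lt_iff₀ hε] at hN
  linarith [hlow N]

/-- The net `indicatorNet M K` converges weak* in `A**`. -/
theorem exists_indicator {A : Type*} [NonUnitalCStarAlgebra A] [PartialOrder A]
    [StarOrderedRing A] (M : NonUnitalStarSubalgebra ℂ A)
    (K : Set (WeakDual.characterSpace ℂ M)) :
    ∃ p : Bidual A, ∀ f : StrongDual ℂ A,
      Tendsto (fun m : indicatorNet M K => f (m : A)) atBot (𝓝 (p f)) := by
  by_cases hbot : (atBot : Filter (indicatorNet M K)) = ⊥
  · exact ⟨0, fun f => by rw [hbot]; exact tendsto_bot⟩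
  have : (atBot : Filter (indicatorNet M K)).NeBot := ⟨hbot⟩
  obtain ⟨m₀⟩ : Nonempty (indicatorNet M K) := Filter.nonempty_of_neBot atBot
  have hlim : ∀ f : StrongDual ℂ A, ∃ z : ℂ,
      Tendsto (fun m : indicatorNet M K => f (m : A)) atBot (𝓝 z) := fun f => by
    refine cauchy_map_iff_exists_tendsto.1 (Metric.cauchy_iff.2 ⟨inferInstance, fun ε hε => ?_⟩)
    obtain ⟨m₁, h₁⟩ := indicatorNet_cauchy M K m₀ f (half_pos hε)
    refine ⟨_, image_mem_map (Iic_mem_atBot m₁), ?_⟩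
    rintro _ ⟨x, hx, rfl⟩ _ ⟨y, hy, rfl⟩
    have hx' := h₁ x hx
    have hy' := h₁ y hy
    rw [← dist_eq_norm] at hx' hy'
    linarith [dist_triangle_right (f (x : A)) (f (y : A)) (f (m₁ : A))]
  choose g hg using hlim
  let q : StrongDual ℂ A →ₗ[ℂ] ℂ :=
    { toFun := g
      map_add' := fun f f' => tendsto_nhds_unique (hg (f + f')) ((hg f).add (hg f'))
      map_smul' := fun c f => tendsto_nhds_unique (hg (c • f)) ((hg f).const_smul c) }
  refine ⟨q.mkContinuous 1 fun f => ?_, hg⟩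
  rw [one_mul]
  refine le_of_tendsto (hg f).norm (Eventually.of_forall fun m => ?_)
  refine (f.le_opNorm _).trans ?_
  calc ‖f‖ * ‖(m : A)‖ ≤ ‖f‖ * 1 := mul_le_mul_of_nonneg_left m.2.2.1 (norm_nonneg _)
    _ = ‖f‖ := mul_one _

/-- The indicator function of a compact `K ⊆ M^σ`, as a projection of `M** ⊆ A**`: the weak* limit
(infimum) of the functions in `M` lying between the indicator of `K` and `1`. -/
def indicator {A : Type*} [NonUnitalCStarAlgebra A] [PartialOrder A] [StarOrderedRing A]
    (M : NonUnitalStarSubalgebra ℂ A) (K : Set (WeakDual.characterSpace ℂ M)) : Bidual A :=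
  (exists_indicator M K).choose

theorem tendsto_indicator {A : Type*} [NonUnitalCStarAlgebra A] [PartialOrder A]
    [StarOrderedRing A] (M : NonUnitalStarSubalgebra ℂ A)
    (K : Set (WeakDual.characterSpace ℂ M)) (f : StrongDual ℂ A) :
    Tendsto (fun m : indicatorNet M K => f (m : A)) atBot (𝓝 (indicator M K f)) :=
  (exists_indicator M K).choose_spec f

/-- The compression `[a]_K = 1_K a 1_K`, an element of `A**`. -/
def corner {A : Type*} [NonUnitalCStarAlgebra A] [PartialOrder A] [StarOrderedRing A]
    (M : NonUnitalStarSubalgebra ℂ A) (K : Set (WeakDual.characterSpace ℂ M)) (a : A) :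
    Bidual A :=
  bidualMul (bidualMul (indicator M K) (toBidual a)) (indicator M K)

/-- The self-adjoint elements of `A` lying in the corner `1_K A 1_K`. -/
def localSA {A : Type*} [NonUnitalCStarAlgebra A] [PartialOrder A] [StarOrderedRing A]
    (M : NonUnitalStarSubalgebra ℂ A) (K : Set (WeakDual.characterSpace ℂ M)) : Set A :=
  {a | IsSelfAdjoint a ∧ corner M K a = toBidual a}

/-- The states `φ` of `A` with `φ(1_K) = 1`. -/
def localStates {A : Type*} [NonUnitalCStarAlgebra A] [PartialOrder A] [StarOrderedRing A]
    (M : NonUnitalStarSubalgebra ℂ A) (K : Set (WeakDual.characterSpace ℂ M)) :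
    Set (StrongDual ℂ A) :=
  {φ | φ ∈ stateSpace A ∧ indicator M K φ = 1}

/-- The Jordan product `(ab + ba) / 2`. -/
def jordanProd {A : Type*} [NonUnitalCStarAlgebra A] (a b : A) : A :=
  (1 / 2 : ℂ) • (a * b + b * a)

/-- The Lie product `(ab - ba) / (2i)`. -/
def lieProd {A : Type*} [NonUnitalCStarAlgebra A] (a b : A) : A :=
  (1 / (2 * Complex.I) : ℂ) • (a * b - b * a)

/-! ### Lipschitz pairs, Lipschitz triples, quantum locally compact metric spaces -/

/-- The self-adjoint part of the smallest unital C⋆-algebra `uA = A + ℂ1` containing `A`, realized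
inside the multiplier algebra of `A`. It is the image of `A` itself when `A` has a unit, and a copy
of the usual unitization otherwise. -/
def unitalSA (A : Type*) [NonUnitalCStarAlgebra A] : Set 𝓜(ℂ, A) :=
  {x | IsSelfAdjoint x ∧ ∃ (a : A) (z : ℂ), x = (a : 𝓜(ℂ, A)) + algebraMap ℂ 𝓜(ℂ, A) z}

/-- A Lipschitz pair `(A, L)`: a seminorm `L` on a dense real subspace of the self-adjoint part of
`uA`, whose kernel is `ℝ1`. The seminorm is given the value `∞` outside of its domain. -/
structure LipschitzPair (A : Type*) [NonUnitalCStarAlgebra A] where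
  /-- the extended seminorm -/
  L : 𝓜(ℂ, A) → ℝ≥0∞
  mem_of_lt_top : ∀ x, L x < ⊤ → x ∈ unitalSA A
  dense_dom : unitalSA A ⊆ closure {x | L x < ⊤}
  add_le : ∀ x y, L (x + y) ≤ L x + L y
  smul_eq : ∀ (t : ℝ) (x : 𝓜(ℂ, A)), L ((t : ℂ) • x) = ENNReal.ofReal |t| * L x
  eq_zero_iff : ∀ x, L x = 0 ↔ ∃ t : ℝ, x = algebraMap ℂ 𝓜(ℂ, A) (t : ℂ)

/-- The value of the Lip-norm at an element of `A` (it is `∞` at elements outside of the domain). -/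
def LipschitzPair.lip {A : Type*} [NonUnitalCStarAlgebra A] (T : LipschitzPair A) (a : A) : ℝ≥0∞ :=
  T.L (a : 𝓜(ℂ, A))

/-- The Monge-Kantorovich extended metric (on functionals on `A`). -/
def LipschitzPair.mkDist {A : Type*} [NonUnitalCStarAlgebra A] (T : LipschitzPair A)
    (φ ψ : StrongDual ℂ A) : ℝ≥0∞ :=
  ⨆ (a : A) (_ : IsSelfAdjoint a ∧ T.lip a ≤ 1), ENNReal.ofReal ‖φ a - ψ a‖

/-- `(A, L)` is a Leibniz Lipschitz pair. -/
def LipschitzPair.IsLeibniz {A : Type*} [NonUnitalCStarAlgebra A] (T : LipschitzPair A) : Prop :=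
  ∀ a b : A, IsSelfAdjoint a → IsSelfAdjoint b →
    T.lip (jordanProd a b) ≤ ENNReal.ofReal ‖a‖ * T.lip b + T.lip a * ENNReal.ofReal ‖b‖ ∧
    T.lip (lieProd a b) ≤ ENNReal.ofReal ‖a‖ * T.lip b + T.lip a * ENNReal.ofReal ‖b‖

/-- `M` is a topography on `A`: an Abelian C⋆-subalgebra containing an approximate unit of `A`. -/
structure IsTopography {A : Type*} [NonUnitalCStarAlgebra A] (M : NonUnitalStarSubalgebra ℂ A) :
    Prop where
  isClosed : IsClosed (M : Set A)
  comm : ∀ a ∈ M, ∀ b ∈ M, a * b = b * a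
  approx : ∃ l : Filter A, l.IsApproximateUnit ∧ (M : Set A) ∈ l

/-- A Lipschitz triple `(A, L, M)`. -/
structure LipschitzTriple (A : Type*) [NonUnitalCStarAlgebra A] extends LipschitzPair A where
  /-- the topography -/
  M : NonUnitalStarSubalgebra ℂ A
  topography : IsTopography M

namespace LipschitzTriple

variable {A : Type*} [NonUnitalCStarAlgebra A]

/-- The Gel'fand spectrum of the topography. -/
abbrev Spec (T : LipschitzTriple A) : Type _ := WeakDual.characterSpace ℂ T.M

/-- The Monge-Kantorovich extended metric of the restriction of `L` to the topography
(on functionals on `M`). -/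
def specDist (T : LipschitzTriple A) (f g : T.M → ℂ) : ℝ≥0∞ :=
  ⨆ (m : T.M) (_ : IsSelfAdjoint (m : A) ∧ T.lip (m : A) ≤ 1), ENNReal.ofReal ‖f m - g m‖

/-- The closed ball of `M^σ` for the Monge-Kantorovich metric of the topography. -/
def specBall (T : LipschitzTriple A) (μ : T.Spec) (r : ℝ) : Set T.Spec :=
  {χ | T.specDist χ μ ≤ ENNReal.ofReal r}

variable [PartialOrder A] [StarOrderedRing A]

/-- The Lipschitz elements supported on `K`. -/
def lipLoc (T : LipschitzTriple A) (K : Set T.Spec) : Set A :=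
  {a | a ∈ localSA T.M K ∧ T.lip a < ⊤}

/-- The Lipschitz, locally supported elements. -/
def lipLocStar (T : LipschitzTriple A) : Set A :=
  ⋃ K : TopologicalSpace.Compacts T.Spec, T.lipLoc K

/-- Tame sets of states: `φ(a - [a]_K)` tends to `0` as `K` ranges over the compact subsets of `M^σ`
(directed by inclusion), uniformly in `φ ∈ S` and in `a` self-adjoint with `L(a) ≤ 1`. -/
def IsTame (T : LipschitzTriple A) (S : Set (StrongDual ℂ A)) : Prop :=
  S ⊆ stateSpace A ∧
    Tendsto (fun K : TopologicalSpace.Compacts T.Spec =>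
      ⨆ (φ : StrongDual ℂ A) (_ : φ ∈ S) (a : A) (_ : IsSelfAdjoint a ∧ T.lip a ≤ 1),
        ENNReal.ofReal ‖φ a - corner T.M (K : Set T.Spec) a φ‖) atTop (𝓝 0)

/-- `(A, L, M)` is a quantum locally compact metric space: on each tame set of states the
Monge-Kantorovich metric induces the weak* topology. -/
def IsQuantumLocallyCompact (T : LipschitzTriple A) : Prop :=
  ∀ S : Set (StrongDual ℂ A), T.IsTame S → ∀ φ ∈ S,
    (𝓝[StrongDual.toWeakDual '' S] (StrongDual.toWeakDual φ)).HasBasis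
      (fun ε : ℝ≥0∞ => 0 < ε)
      (fun ε => StrongDual.toWeakDual '' {ψ | ψ ∈ S ∧ T.mkDist φ ψ < ε})

/-- `(A, L, M)` is a proper quantum metric space. -/
structure IsProperQuantum (T : LipschitzTriple A) : Prop where
  quantumLocallyCompact : T.IsQuantumLocallyCompact
  separable : TopologicalSpace.SeparableSpace A
  leibniz : T.IsLeibniz
  lsc : LowerSemicontinuousOn T.lip {a | IsSelfAdjoint a}
  dense_lipLocStar : {a | IsSelfAdjoint a ∧ T.lip a < ⊤} ⊆ closure T.lipLocStar
  dense_topography : {a | IsSelfAdjoint a ∧ a ∈ T.M} ⊆ closure (T.lipLocStar ∩ (T.M : Set A))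
  /-- the Monge-Kantorovich metric makes `M^σ` a proper metric space -/
  proper : ∃ m : MetricSpace T.Spec, (∀ χ η : T.Spec, m.edist χ η = T.specDist χ η) ∧
    @ProperSpace T.Spec m.toPseudoMetricSpace

end LipschitzTriple

/-- A pointed proper quantum metric space `(A, L, M, μ)`. -/
structure PointedProperQMS (A : Type*) [NonUnitalCStarAlgebra A] [PartialOrder A]
    [StarOrderedRing A] extends LipschitzTriple A where
  isProper : toLipschitzTriple.IsProperQuantum
  /-- the base point -/
  base : WeakDual.characterSpace ℂ M

namespace PointedProperQMS

variable {A : Type*} [NonUnitalCStarAlgebra A] [PartialOrder A] [StarOrderedRing A]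

/-- The Lipschitz elements supported on the closed ball of radius `r` around the base point. -/
def lipBall (X : PointedProperQMS A) (r : ℝ) : Set A :=
  X.lipLoc (X.specBall X.base r)

/-- The states supported on the closed ball of radius `r` around the base point. -/
def stateBall (X : PointedProperQMS A) (r : ℝ) : Set (StrongDual ℂ A) :=
  localStates X.M (X.specBall X.base r)

end PointedProperQMS

/-! ### Passages and tunnels -/

/-- Topographic morphisms. -/
structure IsTopographicMorphism {A B : Type*} [NonUnitalCStarAlgebra A] [NonUnitalCStarAlgebra B]
    (M : NonUnitalStarSubalgebra ℂ A) (N : NonUnitalStarSubalgebra ℂ B) (π : A →⋆ₙₐ[ℂ] B) :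
    Prop where
  surjective : Function.Surjective π
  map_mem : ∀ m ∈ M, π m ∈ N
  approx : ∃ l : Filter A, l.IsApproximateUnit ∧ (M : Set A) ∈ l ∧ (l.map π).IsApproximateUnit

/-- The dual map `φ ↦ φ ∘ π`. -/
def pullback {A B : Type*} [NonUnitalCStarAlgebra A] [NonUnitalCStarAlgebra B] (π : A →⋆ₙₐ[ℂ] B)
    (φ : StrongDual ℂ B) : StrongDual ℂ A :=
  φ.comp
    { toLinearMap := (π : A →ₗ[ℂ] B)
      cont := (NonUnitalStarAlgHom.instContinuousLinearMapClassComplex.map_continuous π) }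

/-- A passage `(D, L_D, M_D, π_A, 𝔸, π_B, 𝔹)` from `X = 𝔸` to `Y = 𝔹`. -/
structure Passage {A B : Type*} [NonUnitalCStarAlgebra A] [PartialOrder A] [StarOrderedRing A]
    [NonUnitalCStarAlgebra B] [PartialOrder B] [StarOrderedRing B]
    (X : PointedProperQMS A) (Y : PointedProperQMS B)
    (D : Type*) [NonUnitalCStarAlgebra D] [PartialOrder D] [StarOrderedRing D]
    extends LipschitzTriple D where
  quantumLocallyCompact : toLipschitzTriple.IsQuantumLocallyCompact
  lsc : LowerSemicontinuousOn toLipschitzTriple.lip {d | IsSelfAdjoint d}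
  /-- the morphism onto the domain -/
  πA : D →⋆ₙₐ[ℂ] A
  /-- the morphism onto the codomain -/
  πB : D →⋆ₙₐ[ℂ] B
  topoA : IsTopographicMorphism M X.M πA
  topoB : IsTopographicMorphism M Y.M πB

namespace Passage

variable {A B D : Type*} [NonUnitalCStarAlgebra A] [PartialOrder A] [StarOrderedRing A]
  [NonUnitalCStarAlgebra B] [PartialOrder B] [StarOrderedRing B]
  [NonUnitalCStarAlgebra D] [PartialOrder D] [StarOrderedRing D]
  {X : PointedProperQMS A} {Y : PointedProperQMS B}

/-- The inverse passage. -/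
def inv (τ : Passage X Y D) : Passage Y X D where
  toLipschitzTriple := τ.toLipschitzTriple
  quantumLocallyCompact := τ.quantumLocallyCompact
  lsc := τ.lsc
  πA := τ.πB
  πB := τ.πA
  topoA := τ.topoB
  topoB := τ.topoA

/-- The lift set of `a` associated with `(l, r, ε, K)`. -/
def liftSet (τ : Passage X Y D) (a : A) (l r ε : ℝ) (K : TopologicalSpace.Compacts τ.Spec) :
    Set D :=
  {d | d ∈ τ.lipLoc K ∧ τ.πA d = a ∧ τ.πB d ∈ Y.lipBall (r + 4 * ε) ∧
    τ.lip d ≤ ENNReal.ofReal l}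

/-- The target set of `a` associated with `(l, r, ε, K)`. -/
def targetSet (τ : Passage X Y D) (a : A) (l r ε : ℝ) (K : TopologicalSpace.Compacts τ.Spec) :
    Set B :=
  τ.πB '' τ.liftSet a l r ε K

/-- `(ε, K)` is `r`-left admissible. -/
structure IsLeftAdmissible (τ : Passage X Y D) (r ε : ℝ) (K : TopologicalSpace.Compacts τ.Spec) :
    Prop where
  pos : 0 < ε
  state_subset : ∀ ψ ∈ X.stateBall r, pullback τ.πA ψ ∈ localStates τ.M K
  state_almost_subset : ∀ φ ∈ localStates τ.M K, ∃ ψ ∈ X.stateBall (r + 4 * ε),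
    τ.mkDist φ (pullback τ.πA ψ) ≤ ENNReal.ofReal ε
  target_nonempty : ∀ a ∈ X.lipBall r, (τ.targetSet a (X.lip a).toReal r ε K).Nonempty
  target_topography : ∀ a ∈ X.lipBall r, a ∈ X.M →
    (τ.targetSet a (X.lip a).toReal r ε K ∩ (Y.M : Set B)).Nonempty
  lip_le : ∀ d ∈ τ.lipLoc K, Y.lip (τ.πB d) ≤ τ.lip d

/-- `(ε, K)` is an `r`-admissible pair. -/
structure IsAdmissiblePair (τ : Passage X Y D) (r ε : ℝ) (K : TopologicalSpace.Compacts τ.Spec) :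
    Prop where
  left : τ.IsLeftAdmissible r ε K
  right : τ.inv.IsLeftAdmissible r ε K
  base : τ.specDist (fun m => X.base ⟨τ.πA m, τ.topoA.map_mem m m.2⟩)
    (fun m => Y.base ⟨τ.πB m, τ.topoB.map_mem m m.2⟩) ≤ ENNReal.ofReal ε
  jordan : ∀ d ∈ τ.lipLoc K, ∀ d' ∈ τ.lipLoc K, τ.lip (jordanProd d d') ≤
    τ.lip d * ENNReal.ofReal ‖d'‖ + τ.lip d' * ENNReal.ofReal ‖d‖
  lie : ∀ d ∈ τ.lipLoc K, ∀ d' ∈ τ.lipLoc K, τ.lip (lieProd d d') ≤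
    τ.lip d * ENNReal.ofReal ‖d'‖ + τ.lip d' * ENNReal.ofReal ‖d‖

/-- `ε` is an `r`-admissible number. -/
def IsAdmissibleNumber (τ : Passage X Y D) (r ε : ℝ) : Prop :=
  0 < ε ∧ ∃ K : ℝ → TopologicalSpace.Compacts τ.Spec,
    (∀ t ∈ Set.Ioc 0 r, ∀ t' ∈ Set.Ioc 0 r, t ≤ t' → K t ≤ K t') ∧
    ∀ t ∈ Set.Ioc 0 r, τ.IsAdmissiblePair t ε (K t)

/-- `τ` is an `r`-tunnel: some number is `r`-admissible. -/
def IsTunnel (τ : Passage X Y D) (r : ℝ) : Prop :=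
  ∃ ε : ℝ, τ.IsAdmissibleNumber r ε

end Passage

end

/-! Everything rests on the norm estimate for a lift `d` of `a`. Since `d` is self-adjoint, `d` or
`-d` attains its norm at a state `φ` of `D`. Because `d` lives in the corner of `1_K`, this state is
automatically supported on `K`. Admissibility then supplies a state `ψ` of `A` with `ψ ∘ π_A` within
`ε` of `φ` for the Monge-Kantorovich metric, so `φ(d)` differs from `ψ(a)` by at most `lε`, and `‖d‖
≤ ‖a‖ + lε`. Elements of the target set inherit the bound, since ⋆-morphisms are contractive.

Lift sets combine linearly because corners and seminorms do; the estimate applied to a difference of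
lifts, whose Lipschitz constant is `2l`, bounds the distance between targets. For products, the
Leibniz inequality on the corner of `K` involves the norms of the lifts, which the estimate
controls.

Two points need work. Membership in a corner is an identity in `A**`; `IsTopography.corner_eq_iff`
turns it into the relations `ma = a = am` for all `m` in the net defining `1_K`, which are stable
under sums and products. This requires `K` to be weak* compact, which for the balls in the spectrum
of `M_B` is `LipschitzTriple.IsProperQuantum.isCompact_specBall`. The support of a norming state is
found in `IsTopography.mem_localStates`. -/

/-! ### Characters of the topography -/

/-- A character of a non-unital C⋆-algebra, as a ⋆-homomorphism. -/
noncomputable def characterStarHom {M : Type*} [NonUnitalCStarAlgebra M] 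
    (χ : WeakDual.characterSpace ℂ M) :
    M →⋆ₙₐ[ℂ] ℂ :=
  { WeakDual.CharacterSpace.toNonUnitalAlgHom χ with
    map_star' := fun a => by
      -- The character extends to the unitization, and characters of a unital C⋆-algebra preserve
      -- the star.
      have h := map_star (Unitization.lift (WeakDual.CharacterSpace.toNonUnitalAlgHom χ))
        (a : Unitization ℂ M)
      rw [← Unitization.inr_star] at h
      simpa [Unitization.lift] using h }

theorem characterStarHom_apply {M : Type*} [NonUnitalCStarAlgebra M]
    (χ : WeakDual.characterSpace ℂ M) (a : M) : characterStarHom χ a = χ a := rfl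

theorem norm_character_apply_le {M : Type*} [NonUnitalCStarAlgebra M]
    (χ : WeakDual.characterSpace ℂ M) (a : M) : ‖χ a‖ ≤ ‖a‖ :=
  NonUnitalStarAlgHom.norm_apply_le (characterStarHom χ) a

theorem character_star_mul_self {M : Type*} [NonUnitalCStarAlgebra M]
    (χ : WeakDual.characterSpace ℂ M) (a : M) : χ (star a * a) = ((‖χ a‖ ^ 2 : ℝ) : ℂ) := by
  rw [← characterStarHom_apply, map_mul, map_star, characterStarHom_apply, Complex.star_def,
    Complex.conj_mul']
  push_cast
  rfl

theorem character_exists_apply_ne_zero {M : Type*} [NonUnitalCStarAlgebra M]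
    (χ : WeakDual.characterSpace ℂ M) : ∃ a : M, χ a ≠ 0 := by
  by_contra! h
  exact χ.2.1 (ContinuousLinearMap.ext h)

theorem continuous_character_apply {M : Type*} [NonUnitalCStarAlgebra M] (a : M) :
    Continuous fun χ : WeakDual.characterSpace ℂ M => χ a :=
  (WeakDual.eval_continuous a).comp continuous_subtype_val

/-- On a compact set of characters, some positive element is bounded below. -/
theorem exists_isSelfAdjoint_character_ge {M : Type*} [NonUnitalCStarAlgebra M]
    {K : Set (WeakDual.characterSpace ℂ M)} (hK : IsCompact K) :
    ∃ h : M, IsSelfAdjoint h ∧ ∃ δ > 0, ∀ χ ∈ K, ∃ s : ℝ, δ ≤ s ∧ χ h = s := by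
  choose a ha using fun χ : WeakDual.characterSpace ℂ M => character_exists_apply_ne_zero χ
  -- Finitely many elements `a χ` have no common zero on `K`; the transform of the sum of their
  -- `star a * a` is then continuous and positive on `K`, and its minimum there serves as `δ`.
  obtain ⟨t, ht⟩ := hK.elim_finite_subcover
    (fun χ : WeakDual.characterSpace ℂ M => {η : WeakDual.characterSpace ℂ M | η (a χ) ≠ 0})
    (fun χ => isOpen_ne_fun (continuous_character_apply _) continuous_const)
    (fun χ _ => Set.mem_iUnion.2 ⟨χ, ha χ⟩)
  have hval : ∀ η : WeakDual.characterSpace ℂ M,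
      η (∑ χ ∈ t, star (a χ) * a χ) = ((∑ χ ∈ t, ‖η (a χ)‖ ^ 2 : ℝ) : ℂ) := fun η => by
    rw [map_sum, Complex.ofReal_sum]
    exact Finset.sum_congr rfl fun χ _ => character_star_mul_self η (a χ)
  refine ⟨∑ χ ∈ t, star (a χ) * a χ,
    isSelfAdjoint_sum t fun χ _ => IsSelfAdjoint.star_mul_self _, ?_⟩
  have hcont : Continuous fun η : WeakDual.characterSpace ℂ M => ∑ χ ∈ t, ‖η (a χ)‖ ^ 2 :=
    continuous_finsetSum t fun χ _ => (continuous_character_apply (a χ)).norm.pow 2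
  rcases K.eq_empty_or_nonempty with rfl | hne
  · exact ⟨1, one_pos, fun χ hχ => hχ.elim⟩
  obtain ⟨η₀, h₀, hmin⟩ := hK.exists_isMinOn hne hcont.continuousOn
  refine ⟨∑ χ ∈ t, ‖η₀ (a χ)‖ ^ 2, ?_, fun η hη => ⟨_, hmin hη, hval η⟩⟩
  obtain ⟨χ, hχ⟩ := Set.mem_iUnion.1 (ht h₀)
  obtain ⟨hχt, hχ0⟩ := Set.mem_iUnion.1 hχ
  exact Finset.sum_pos' (fun _ _ => by positivity) ⟨χ, hχt, by
    have := norm_pos_iff.2 hχ0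
    positivity⟩

/-- A Urysohn lemma: for compact `K` there is a contraction in `M`, equal to `1` on `K`. -/
theorem exists_norm_le_one_character_eq_one {M : Type*} [NonUnitalCStarAlgebra M]
    {K : Set (WeakDual.characterSpace ℂ M)} (hK : IsCompact K) :
    ∃ y : M, ‖y‖ ≤ 1 ∧ ∀ χ ∈ K, χ y = 1 := by
  obtain ⟨h, hsa, δ, hδ, hge⟩ := exists_isSelfAdjoint_character_ge hK
  -- The cutoff equals `1` on `[δ, ∞)`, where `h` takes its values on `K`, and vanishes at `0` as
  -- the non-unital functional calculus requires. Characters commute with this calculus.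
  let f : ℝ → ℝ := fun t => min (|t| / δ) 1
  have hf : Continuous f := by fun_prop
  have hf0 : f 0 = 0 := by simp [f]
  refine ⟨cfcₙ f h, norm_cfcₙ_le fun x _ => ?_, fun χ hχ => ?_⟩
  · rw [Real.norm_of_nonneg (le_min (by positivity) zero_le_one)]
    exact min_le_right _ _
  · obtain ⟨s, hs, hχs⟩ := hge χ hχ
    have hsa' : IsSelfAdjoint (characterStarHom χ h) := hsa.map _
    have h1 := NonUnitalStarAlgHom.map_cfcₙ (characterStarHom χ) f h hf.continuousOn hf0
      (NonUnitalStarAlgHom.instContinuousLinearMapClassComplex.map_continuous _) hsa hsa'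
    rw [characterStarHom_apply, characterStarHom_apply, hχs] at h1
    rw [h1, cfcₙ_eq_cfc hf.continuousOn hf0]
    have h2 := cfc_algebraMap (A := ℂ) s f
    have h3 : f s = 1 := by
      refine min_eq_right ((one_le_div hδ).2 (hs.trans (le_abs_self s)))
    rw [h3] at h2
    simpa using h2

/-! ### The net of functions above the indicator of a compact set -/

section indicatorNet

variable {A : Type*} [NonUnitalCStarAlgebra A] [PartialOrder A]
  {M : NonUnitalStarSubalgebra ℂ A} {K : Set (WeakDual.characterSpace ℂ M)}

theorem IsTopography.comm_indicatorNet (hM : IsTopography M) (m n : indicatorNet M K) :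
    (m : A) * n = n * m :=
  hM.comm _ m.2.2.2.1 _ n.2.2.2.1

variable [StarOrderedRing A]

/-- The Urysohn element `y` need not be positive, but `star y * y` is, and it still equals `1` on
`K`. Compactness of `K` enters the study of the net only through this fact: it makes `atBot` a
proper filter, so that limits along it are unique. -/
theorem IsTopography.nonempty_indicatorNet (hM : IsTopography M) (hK : IsCompact K) :
    Nonempty (indicatorNet M K) := by
  have : IsClosed (M : Set A) := hM.isClosed
  obtain ⟨y, hy, h1⟩ := exists_norm_le_one_character_eq_one hK
  refine ⟨⟨((star y * y : M) : A), star_mul_self_nonneg (y : A), ?_, (star y * y).2,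
    fun χ hχ => ?_⟩⟩
  · have h2 : ‖star y * y‖ ≤ 1 := by
      rw [CStarRing.norm_star_mul_self]
      exact mul_le_one₀ hy (norm_nonneg _) hy
    exact h2
  · refine (character_star_mul_self χ y).trans ?_
    simp [h1 χ hχ]

/-- The square root of `a` also commutes with `b`, so `ab = √a b √a ≤ ‖b‖ a`. -/
theorem mul_le_left_of_commute {a b : A} (ha : 0 ≤ a) (hb : 0 ≤ b) (hb1 : ‖b‖ ≤ 1)
    (hab : a * b = b * a) : a * b ≤ a := by
  have hs : 0 ≤ CFC.sqrt a := CFC.sqrt_nonneg a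
  have hss : CFC.sqrt a * CFC.sqrt a = a := CFC.sqrt_mul_sqrt_self a
  have hcomm : Commute (CFC.sqrt a) b := by
    exact Commute.cfcₙ_nnreal hab _
  have h := CStarAlgebra.star_left_conjugate_le_norm_smul (a := CFC.sqrt a) (b := b)
    (IsSelfAdjoint.of_nonneg hb)
  rw [(IsSelfAdjoint.of_nonneg hs).star_eq, hcomm.eq, mul_assoc, hss, ← hab] at h
  refine h.trans ?_
  calc ‖b‖ • a ≤ (1 : ℝ) • a := smul_le_smul_of_nonneg_right hb1 ha
    _ = a := one_smul _ _

/-- Closure under products makes the net codirected, since `mn` is a lower bound of both `m` and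
`n`. -/
theorem IsTopography.mul_mem_indicatorNet (hM : IsTopography M) {m n : A}
    (hm : m ∈ indicatorNet M K) (hn : n ∈ indicatorNet M K) : m * n ∈ indicatorNet M K := by
  obtain ⟨hm0, hm1, hmM, hmK⟩ := hm
  obtain ⟨hn0, hn1, hnM, hnK⟩ := hn
  refine ⟨Commute.mul_nonneg hm0 hn0 (hM.comm m hmM n hnM),
    (norm_mul_le _ _).trans (mul_le_one₀ hm1 (norm_nonneg _) hn1), mul_mem hmM hnM,
    fun χ hχ => ?_⟩
  have h := map_mul χ (⟨m, hmM⟩ : M) ⟨n, hnM⟩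
  rw [hmK χ hχ, hnK χ hχ, one_mul] at h
  exact h

/-- Multiplication by `m`, as a self-map of the net. -/
def IsTopography.mulNet (hM : IsTopography M) (m : indicatorNet M K) (n : indicatorNet M K) :
    indicatorNet M K :=
  ⟨m * n, hM.mul_mem_indicatorNet m.2 n.2⟩

theorem IsTopography.mulNet_le_left (hM : IsTopography M) (m n : indicatorNet M K) :
    hM.mulNet m n ≤ m :=
  mul_le_left_of_commute m.2.1 n.2.1 n.2.2.1 (hM.comm_indicatorNet m n)

theorem IsTopography.mulNet_le_right (hM : IsTopography M) (m n : indicatorNet M K) :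
    hM.mulNet m n ≤ n := by
  have h := mul_le_left_of_commute n.2.1 m.2.1 m.2.2.1 (hM.comm_indicatorNet n m)
  rw [← hM.comm_indicatorNet m n] at h
  exact h

theorem IsTopography.atBot_indicatorNet_neBot (hM : IsTopography M) (hK : IsCompact K) :
    (atBot : Filter (indicatorNet M K)).NeBot := by
  have := hM.nonempty_indicatorNet hK
  have : IsCodirectedOrder (indicatorNet M K) :=
    ⟨fun m n => ⟨hM.mulNet m n, hM.mulNet_le_left m n, hM.mulNet_le_right m n⟩⟩
  infer_instance

/-- Limits along the net are unchanged when `n` is replaced by `mn`; this is how `1_K` absorbs `m`.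
-/
theorem IsTopography.tendsto_mulNet (hM : IsTopography M) (m : indicatorNet M K) :
    Tendsto (hM.mulNet m) atBot atBot :=
  tendsto_atBot_mono (hM.mulNet_le_right m) tendsto_id

/-- `1_K m = 1_K` for each `m` in the net. -/
theorem IsTopography.indicator_mul_right (hM : IsTopography M) (hK : IsCompact K)
    (m : indicatorNet M K) (f g : StrongDual ℂ A) (hfg : ∀ a, g a = f (a * m)) :
    indicator M K g = indicator M K f := by
  have := hM.atBot_indicatorNet_neBot hK
  refine tendsto_nhds_unique (tendsto_indicator M K g)
    (((tendsto_indicator M K f).comp (hM.tendsto_mulNet m)).congr fun n => ?_)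
  rw [hfg, ← hM.comm_indicatorNet m n]
  rfl

/-- `m 1_K = 1_K` for each `m` in the net. -/
theorem IsTopography.indicator_mul_left (hM : IsTopography M) (hK : IsCompact K)
    (m : indicatorNet M K) (f g : StrongDual ℂ A) (hfg : ∀ a, g a = f (m * a)) :
    indicator M K g = indicator M K f := by
  have := hM.atBot_indicatorNet_neBot hK
  refine tendsto_nhds_unique (tendsto_indicator M K g)
    (((tendsto_indicator M K f).comp (hM.tendsto_mulNet m)).congr fun n => ?_)
  rw [hfg]
  rfl

end indicatorNet

/-! ### Elements supported on a compact set -/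

section localSA

variable {A : Type*} [NonUnitalCStarAlgebra A]

theorem bidualAct_toBidual_apply (a b : A) (f : StrongDual ℂ A) :
    bidualAct (toBidual a) f b = f (b * a) := rfl

theorem eq_of_forall_dual_eq {a b : A} (h : ∀ f : StrongDual ℂ A, f a = f b) : a = b :=
  (SeparatingDual.eq_iff_forall_dual_eq (R := ℂ)).2 h

theorem IsSelfAdjoint.ofReal_smul {a : A} (ha : IsSelfAdjoint a) (t : ℝ) :
    IsSelfAdjoint ((t : ℂ) • a) :=
  IsSelfAdjoint.smul (Complex.conj_ofReal t) ha

theorem IsSelfAdjoint.jordanProd {a b : A} (ha : IsSelfAdjoint a) (hb : IsSelfAdjoint b) :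
    IsSelfAdjoint (jordanProd a b) := by
  rw [IsSelfAdjoint, _root_.jordanProd, star_smul, star_add, star_mul, star_mul, ha.star_eq,
    hb.star_eq, add_comm]
  simp

theorem IsSelfAdjoint.lieProd {a b : A} (ha : IsSelfAdjoint a) (hb : IsSelfAdjoint b) :
    IsSelfAdjoint (lieProd a b) := by
  rw [IsSelfAdjoint, _root_.lieProd, star_smul, star_sub, star_mul, star_mul, ha.star_eq,
    hb.star_eq, ← neg_sub (a * b), smul_neg, ← neg_smul]
  simp

variable [PartialOrder A] [StarOrderedRing A]
  {M : NonUnitalStarSubalgebra ℂ A} {K : Set (WeakDual.characterSpace ℂ M)}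

theorem corner_apply (a : A) (f : StrongDual ℂ A) :
    corner M K a f = indicator M K ((bidualAct (toBidual a)) (bidualAct (indicator M K) f)) :=
  rfl

/-- One direction holds because `1_K` absorbs every `m` of the net on either side. Conversely, if
`a` absorbs every `m`, the nets whose limits define the two factors `1_K` are constant. -/
theorem IsTopography.corner_eq_iff (hM : IsTopography M) (hK : IsCompact K) (a : A) :
    corner M K a = toBidual a ↔ ∀ m ∈ indicatorNet M K, m * a = a ∧ a * m = a := by
  have := hM.atBot_indicatorNet_neBot hK
  constructor
  · intro h m hm
    have hf : ∀ f : StrongDual ℂ A, corner M K a f = f a := fun f => by rw [h]; rfl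
    refine ⟨eq_of_forall_dual_eq fun f => ?_, eq_of_forall_dual_eq fun f => ?_⟩
    -- A left factor `m` is absorbed by the outer indicator; in the next case, a right factor is
    -- absorbed by the inner one.
    · have h1 : f (m * a) = (f.comp (ContinuousLinearMap.mul ℂ A m)) a := rfl
      rw [h1, ← hf, ← hf, corner_apply, corner_apply]
      refine hM.indicator_mul_left hK ⟨m, hm⟩ _ _ fun b => ?_
      rw [bidualAct_toBidual_apply, bidualAct_toBidual_apply, bidualAct_apply, bidualAct_apply]
      congr 1
      ext c
      simp [mul_assoc]
    · have h1 : f (a * m) = (f.comp ((ContinuousLinearMap.mul ℂ A).flip m)) a := rfl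
      rw [h1, ← hf, ← hf, corner_apply, corner_apply]
      congr 1
      ext b
      rw [bidualAct_toBidual_apply, bidualAct_toBidual_apply, bidualAct_apply, bidualAct_apply]
      refine hM.indicator_mul_right hK ⟨m, hm⟩ _ _ fun c => ?_
      simp [mul_assoc]
  · intro h
    ext f
    have h1 : bidualAct (toBidual a) (bidualAct (indicator M K) f) =
        f.comp ((ContinuousLinearMap.mul ℂ A).flip a) := by
      ext b
      rw [bidualAct_toBidual_apply, bidualAct_apply]
      refine tendsto_nhds_unique (tendsto_indicator M K _)
        (tendsto_const_nhds.congr fun m => ?_)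
      simp [mul_assoc, (h m m.2).2]
    rw [corner_apply, h1]
    refine tendsto_nhds_unique (tendsto_indicator M K _) (tendsto_const_nhds.congr fun m => ?_)
    simp [toBidual, (h m m.2).1]

theorem IsTopography.mem_localSA_iff (hM : IsTopography M) (hK : IsCompact K) (a : A) :
    a ∈ localSA M K ↔ IsSelfAdjoint a ∧ ∀ m ∈ indicatorNet M K, m * a = a ∧ a * m = a :=
  and_congr_right fun _ => hM.corner_eq_iff hK a

theorem IsTopography.add_smul_mem_localSA (hM : IsTopography M) (hK : IsCompact K) {a b : A}
    (ha : a ∈ localSA M K) (hb : b ∈ localSA M K) (t : ℝ) : a + (t : ℂ) • b ∈ localSA M K := by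
  rw [hM.mem_localSA_iff hK] at *
  refine ⟨ha.1.add (hb.1.ofReal_smul t), fun m hm => ?_⟩
  rw [mul_add, add_mul, mul_smul_comm, smul_mul_assoc, (ha.2 m hm).1, (ha.2 m hm).2,
    (hb.2 m hm).1, (hb.2 m hm).2]
  exact ⟨rfl, rfl⟩

theorem IsTopography.jordanProd_mem_localSA (hM : IsTopography M) (hK : IsCompact K) {a b : A}
    (ha : a ∈ localSA M K) (hb : b ∈ localSA M K) : jordanProd a b ∈ localSA M K := by
  rw [hM.mem_localSA_iff hK] at *
  refine ⟨ha.1.jordanProd hb.1, fun m hm => ?_⟩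
  rw [jordanProd, mul_smul_comm, smul_mul_assoc, mul_add, add_mul, ← mul_assoc, ← mul_assoc,
    mul_assoc a, mul_assoc b, (ha.2 m hm).1, (ha.2 m hm).2, (hb.2 m hm).1, (hb.2 m hm).2]
  exact ⟨rfl, rfl⟩

theorem IsTopography.lieProd_mem_localSA (hM : IsTopography M) (hK : IsCompact K) {a b : A}
    (ha : a ∈ localSA M K) (hb : b ∈ localSA M K) : lieProd a b ∈ localSA M K := by
  rw [hM.mem_localSA_iff hK] at *
  refine ⟨ha.1.lieProd hb.1, fun m hm => ?_⟩
  rw [lieProd, mul_smul_comm, smul_mul_assoc, mul_sub, sub_mul, ← mul_assoc, ← mul_assoc,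
    mul_assoc a, mul_assoc b, (ha.2 m hm).1, (ha.2 m hm).2, (hb.2 m hm).1, (hb.2 m hm).2]
  exact ⟨rfl, rfl⟩

end localSA

/-! ### States -/

/-- A unital contractive functional is real on self-adjoint elements. -/
theorem im_apply_eq_zero_of_unital_contraction {U : Type*} [CStarAlgebra U] {f : StrongDual ℂ U}
    (hf : ‖f‖ ≤ 1) (h1 : f 1 = 1) {x : U} (hx : IsSelfAdjoint x) : (f x).im = 0 := by
  -- Evaluate at `x + it`: the image has imaginary part `Im f(x) + t`, while `‖x + it‖² ≤ ‖x‖² +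
  -- t²`. For large `t` of the right sign this is impossible unless `Im f(x) = 0`.
  have key : ∀ t : ℝ, ((f x).im + t) ^ 2 ≤ ‖x‖ ^ 2 + t ^ 2 := fun t => by
    have h2 : f (x + (t * Complex.I) • 1) = f x + t * Complex.I := by
      rw [map_add, map_smul, h1, smul_eq_mul, mul_one]
    have h3 : ‖f (x + (t * Complex.I) • 1)‖ ≤ ‖x + ((t : ℂ) * Complex.I) • (1 : U)‖ :=
      (f.le_of_opNorm_le hf _).trans_eq (one_mul _)
    have h4 : ‖x + ((t : ℂ) * Complex.I) • (1 : U)‖ ^ 2 ≤ ‖x‖ ^ 2 + t ^ 2 := by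
      have h5 : star (x + ((t : ℂ) * Complex.I) • (1 : U)) * (x + ((t : ℂ) * Complex.I) • (1 : U))
          = x * x + ((t ^ 2 : ℝ) : ℂ) • (1 : U) := by
        have h6 : star ((t : ℂ) * Complex.I) = -((t : ℂ) * Complex.I) := by simp
        have h7 : ((t : ℂ) * Complex.I) * ((t : ℂ) * Complex.I) = -((t ^ 2 : ℝ) : ℂ) := by
          push_cast
          linear_combination (t : ℂ) ^ 2 * Complex.I_mul_I
        rw [star_add, star_smul, star_one, hx.star_eq, h6, add_mul, mul_add, mul_add,
          smul_mul_smul_comm, neg_mul, h7]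
        simp
      rw [sq, ← CStarRing.norm_star_mul_self, h5]
      have hone : ‖(1 : U)‖ ≤ 1 := by
        rcases subsingleton_or_nontrivial U with h | h
        · rw [Subsingleton.elim (1 : U) 0, norm_zero]; exact zero_le_one
        · exact CStarRing.norm_one.le
      refine (norm_add_le _ _).trans (add_le_add ?_ ?_)
      · exact (norm_mul_le _ _).trans_eq (sq _).symm
      · rw [norm_smul, Complex.norm_real, Real.norm_of_nonneg (sq_nonneg t)]
        exact mul_le_of_le_one_right (sq_nonneg t) hone
    have h8 : ((f x).im + t) ^ 2 ≤ ‖f x + t * Complex.I‖ ^ 2 := by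
      have h9 : |(f x).im + t| ≤ ‖f x + t * Complex.I‖ := by
        simpa using Complex.abs_im_le_norm (f x + t * Complex.I)
      rw [← sq_abs]
      gcongr
    rw [h2] at h3
    exact h8.trans ((pow_le_pow_left₀ (norm_nonneg _) h3 2).trans h4)
  by_contra hne
  -- This `t` makes the cross term `2 t Im f(x)` equal to `‖x‖² + 1`.
  have h2 := key ((‖x‖ ^ 2 + 1) / (2 * (f x).im))
  have h3 : 2 * (f x).im * ((‖x‖ ^ 2 + 1) / (2 * (f x).im)) = ‖x‖ ^ 2 + 1 := by field_simp
  nlinarith [sq_nonneg (f x).im]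

/-- A unital contractive functional is positive. -/
theorem re_apply_star_mul_self_nonneg_of_unital_contraction {U : Type*} [CStarAlgebra U]
    {f : StrongDual ℂ U} (hf : ‖f‖ ≤ 1) (h1 : f 1 = 1) (a : U) : 0 ≤ (f (star a * a)).re := by
  let _ : PartialOrder U := CStarAlgebra.spectralOrder U
  have : StarOrderedRing U := CStarAlgebra.spectralOrderedRing U
  set x : U := star a * a with hx
  have hx0 : 0 ≤ x := star_mul_self_nonneg a
  have h2 : 0 ≤ algebraMap ℝ U ‖x‖ - x :=
    sub_nonneg.2 (IsSelfAdjoint.le_algebraMap_norm_self (.of_nonneg hx0))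
  -- As `0 ≤ ‖x‖ - x ≤ ‖x‖`, contractivity puts `f x` in the disc of centre and radius `‖x‖`, which
  -- lies in the right half-plane.
  have h3 : ‖algebraMap ℝ U ‖x‖ - x‖ ≤ ‖x‖ := by
    refine (CStarAlgebra.norm_le_iff_le_algebraMap _ (norm_nonneg _) h2).2 ?_
    exact sub_le_self _ hx0
  have h4 : f (algebraMap ℝ U ‖x‖) = ‖x‖ := by
    rw [Algebra.algebraMap_eq_smul_one, ← Complex.coe_smul, map_smul, h1, smul_eq_mul, mul_one]
  have h5 : ‖(‖x‖ : ℂ) - f x‖ ≤ ‖x‖ := by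
    rw [← h4, ← map_sub]
    exact (f.le_of_opNorm_le hf _).trans ((one_mul _).trans_le h3)
  have h6 := (Complex.re_le_norm _).trans h5
  rw [Complex.sub_re, Complex.ofReal_re] at h6
  linarith

/-- The restriction to `A` of a unital contractive functional on the unitization is a state as
soon as it attains the norm of a nonzero element. -/
theorem restrict_mem_stateSpace {A : Type*} [NonUnitalCStarAlgebra A]
    {f : StrongDual ℂ (Unitization ℂ A)} (hf : ‖f‖ ≤ 1) (h1 : f 1 = 1)
    {φ : StrongDual ℂ A} (hφ : ∀ a : A, φ a = f a) {d : A} (hd : d ≠ 0) (hfd : ‖d‖ ≤ ‖φ d‖) :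
    φ ∈ stateSpace A := by
  refine ⟨le_antisymm (φ.opNorm_le_bound zero_le_one fun a => ?_) ?_, fun a => ?_⟩
  · rw [hφ, ← Unitization.norm_inr (𝕜 := ℂ) a]
    exact f.le_of_opNorm_le hf _
  · have h2 := hfd.trans (φ.le_opNorm d)
    have h3 := norm_pos_iff.2 hd
    nlinarith
  · rw [hφ]
    refine ⟨?_, im_apply_eq_zero_of_unital_contraction hf h1 ((IsSelfAdjoint.star_mul_self a).inr ℂ)⟩
    rw [Unitization.inr_mul, Unitization.inr_star]
    exact re_apply_star_mul_self_nonneg_of_unital_contraction hf h1 _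

/-- A Hahn-Banach functional norming `d` alone need not be positive. One norming `‖d‖1 + d`, whose
norm is at least `2‖d‖`, must satisfy both `f 1 = 1` and `f d = ‖d‖`, as neither term can contribute
more than `‖d‖`; the first equality gives positivity. -/
theorem exists_state_apply_eq_norm_of_mem_spectrum {A : Type*} [NonUnitalCStarAlgebra A] {d : A}
    (h0 : d ≠ 0) (hmem : ‖d‖ ∈ spectrum ℝ (d : Unitization ℂ A)) :
    ∃ φ ∈ stateSpace A, φ d = ‖d‖ := by
  have hpos := norm_pos_iff.2 h0
  have hone : ‖(1 : Unitization ℂ A)‖ = 1 := CStarRing.norm_one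
  set x : Unitization ℂ A := algebraMap ℝ _ ‖d‖ + (d : Unitization ℂ A) with hx
  have hxm : ‖d‖ + ‖d‖ ∈ spectrum ℝ x := by
    rw [hx]
    exact spectrum.add_mem_add_iff.2 hmem
  have hxn : ‖d‖ + ‖d‖ ≤ ‖x‖ := (le_abs_self _).trans (spectrum.norm_le_norm_of_mem hxm)
  have hx0 : x ≠ 0 := fun h => by rw [h, norm_zero] at hxn; linarith
  obtain ⟨f, hf, hfx⟩ := exists_dual_vector ℂ x (norm_ne_zero_iff.2 hx0)
  have hfd : ‖f d‖ ≤ ‖d‖ := by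
    refine (f.le_opNorm _).trans_eq ?_
    rw [hf, one_mul, Unitization.norm_inr]
  have hf1 : ‖f 1‖ ≤ 1 := (f.le_opNorm _).trans_eq (by rw [hf, one_mul, hone])
  have hsum : f x = ‖d‖ * f 1 + f d := by
    rw [hx, map_add, Algebra.algebraMap_eq_smul_one, ← Complex.coe_smul, map_smul, smul_eq_mul]
  rw [hfx] at hsum
  have hre := congrArg Complex.re hsum
  simp only [Complex.coe_algebraMap, Complex.add_re, Complex.re_ofReal_mul,
    Complex.ofReal_re] at hre
  have h1re := (Complex.re_le_norm _).trans hf1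
  have hdre := (Complex.re_le_norm _).trans hfd
  have e1 : (f 1).re = 1 := by nlinarith
  have e2 : (f d).re = ‖d‖ := by nlinarith
  -- A complex number whose real part already reaches the bound on its modulus has no imaginary
  -- part.
  have hsq : ∀ (z : ℂ) (s : ℝ), ‖z‖ ≤ s → z.re = s → z = s := fun z s hz hs => by
    have h2 := Complex.sq_norm z
    rw [Complex.normSq_apply] at h2
    have h3 := norm_nonneg z
    have h4 : z.im = 0 := by nlinarith
    exact Complex.ext (by simpa using hs) (by simpa using h4)
  have hf1' : f 1 = 1 := by simpa using hsq _ _ hf1 e1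
  have hfd' : f d = ‖d‖ := hsq _ _ hfd e2
  let φ : StrongDual ℂ A := f.comp
    { toLinearMap := Unitization.inrHom ℂ ℂ A
      cont := (Unitization.isometry_inr (𝕜 := ℂ)).continuous }
  have hφd : φ d = ‖d‖ := hfd'
  refine ⟨φ, restrict_mem_stateSpace hf.le hf1' (fun _ => rfl) h0 ?_, hφd⟩
  rw [hφd, Complex.norm_real, norm_norm]

/-- The norm of a self-adjoint element is attained at a state. -/
theorem exists_state_norm_apply_eq {A : Type*} [NonUnitalCStarAlgebra A] {d : A}
    (hd : IsSelfAdjoint d) (h0 : d ≠ 0) :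
    ∃ φ ∈ stateSpace A, φ d = ‖d‖ ∨ φ (-d) = ‖d‖ := by
  have hspec := CStarAlgebra.norm_or_neg_norm_mem_spectrum (hd.inr ℂ)
  rw [Unitization.norm_inr] at hspec
  rcases hspec with h | h
  · obtain ⟨φ, hφ, he⟩ := exists_state_apply_eq_norm_of_mem_spectrum h0 h
    exact ⟨φ, hφ, Or.inl he⟩
  · have h2 : ‖-d‖ ∈ spectrum ℝ ((-d : A) : Unitization ℂ A) := by
      rw [norm_neg, Unitization.inr_neg, ← spectrum.neg_eq]
      exact h
    obtain ⟨φ, hφ, he⟩ := exists_state_apply_eq_norm_of_mem_spectrum (neg_ne_zero.2 h0) h2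
    exact ⟨φ, hφ, Or.inr (by rw [he, norm_neg])⟩

theorem re_apply_mono_of_mem_stateSpace {A : Type*} [NonUnitalCStarAlgebra A] [PartialOrder A]
    [StarOrderedRing A] {φ : StrongDual ℂ A} (hφ : φ ∈ stateSpace A) {a b : A} (hab : a ≤ b) :
    (φ a).re ≤ (φ b).re := by
  obtain ⟨y, hy⟩ := CStarAlgebra.nonneg_iff_eq_star_mul_self.1 (sub_nonneg.2 hab)
  have h := (hφ.2 y).1
  rw [← hy, map_sub, Complex.sub_re] at h
  linarith

theorem im_apply_eq_zero_of_mem_stateSpace {A : Type*} [NonUnitalCStarAlgebra A] [PartialOrder A]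
    [StarOrderedRing A] {φ : StrongDual ℂ A} (hφ : φ ∈ stateSpace A) {a : A} (ha : 0 ≤ a) :
    (φ a).im = 0 := by
  obtain ⟨y, rfl⟩ := CStarAlgebra.nonneg_iff_eq_star_mul_self.1 ha
  exact (hφ.2 y).2

/-- A state attaining the norm of an element supported on `K` is supported on `K`. -/
theorem IsTopography.mem_localStates {A : Type*} [NonUnitalCStarAlgebra A] [PartialOrder A]
    [StarOrderedRing A] {M : NonUnitalStarSubalgebra ℂ A}
    {K : Set (WeakDual.characterSpace ℂ M)} (hM : IsTopography M) (hK : IsCompact K)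
    {φ : StrongDual ℂ A} (hφ : φ ∈ stateSpace A) {e : A} (he : e ∈ localSA M K) (h0 : e ≠ 0)
    (hφe : φ e = ‖e‖) : φ ∈ localStates M K := by
  have := hM.atBot_indicatorNet_neBot hK
  rw [hM.mem_localSA_iff hK] at he
  refine ⟨hφ, tendsto_nhds_unique (tendsto_indicator M K φ)
    (tendsto_const_nhds.congr fun m => ?_)⟩
  have hm0 : (0 : A) ≤ m := m.2.1
  have hpos := norm_pos_iff.2 h0
  -- Indeed `e = mem ≤ ‖e‖ m² ≤ ‖e‖ m`. Applying `φ` gives `φ(m) ≥ 1`, hence `φ(m) = 1` for every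
  -- `m` in the net, and so in the limit.
  have h1 : e ≤ ‖e‖ • (m : A) := by
    have h2 := CStarAlgebra.star_left_conjugate_le_norm_smul (a := (m : A)) (b := e) he.1
    rw [(IsSelfAdjoint.of_nonneg hm0).star_eq, (he.2 m m.2).1, (he.2 m m.2).2] at h2
    exact h2.trans (smul_le_smul_of_nonneg_left
      (mul_le_left_of_commute hm0 hm0 m.2.2.1 rfl) hpos.le)
  have h2 := re_apply_mono_of_mem_stateSpace hφ h1
  rw [← Complex.coe_smul, map_smul, smul_eq_mul, Complex.re_ofReal_mul, hφe,
    Complex.ofReal_re] at h2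
  have h3 : (φ m).re ≤ 1 := by
    refine (Complex.re_le_norm _).trans ((φ.le_opNorm _).trans ?_)
    rw [hφ.1, one_mul]
    exact m.2.2.1
  refine (Complex.ext ?_ ?_).symm
  · rw [Complex.one_re]
    nlinarith
  · rw [Complex.one_im]
    exact im_apply_eq_zero_of_mem_stateSpace hφ hm0

/-! ### Lipschitz seminorms -/

namespace LipschitzPair

variable {A : Type*} [NonUnitalCStarAlgebra A] (T : LipschitzPair A)

theorem lip_smul (t : ℝ) (a : A) : T.lip ((t : ℂ) • a) = ENNReal.ofReal |t| * T.lip a := by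
  have h : (((t : ℂ) • a : A) : 𝓜(ℂ, A)) = (t : ℂ) • (a : 𝓜(ℂ, A)) :=
    map_smul (DoubleCentralizer.coeHom (𝕜 := ℂ) (A := A)) (t : ℂ) a
  rw [lip, h, T.smul_eq, lip]

theorem lip_add_le (a b : A) : T.lip (a + b) ≤ T.lip a + T.lip b := by
  have h : ((a + b : A) : 𝓜(ℂ, A)) = (a : 𝓜(ℂ, A)) + (b : 𝓜(ℂ, A)) :=
    map_add (DoubleCentralizer.coeHom (𝕜 := ℂ) (A := A)) a b
  rw [lip, h]
  exact T.add_le _ _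

theorem lip_inv_smul_le_one {a : A} {l : ℝ} (hl : 0 < l) (ha : T.lip a ≤ ENNReal.ofReal l) :
    T.lip (((l⁻¹ : ℝ) : ℂ) • a) ≤ 1 := by
  rw [T.lip_smul, abs_of_pos (inv_pos.2 hl)]
  refine (mul_le_mul_right ha _).trans ?_
  rw [← ENNReal.ofReal_mul (inv_pos.2 hl).le, inv_mul_cancel₀ hl.ne', ENNReal.ofReal_one]

theorem norm_sub_le_of_mkDist_le {φ ψ : StrongDual ℂ A} {a : A} {l ε : ℝ} (hl : 0 ≤ l)
    (hε : 0 ≤ ε) (hsa : IsSelfAdjoint a) (ha : T.lip a ≤ ENNReal.ofReal l)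
    (h : T.mkDist φ ψ ≤ ENNReal.ofReal ε) : ‖φ a - ψ a‖ ≤ l * ε := by
  -- Rescaling by `l⁻¹` fails when `l = 0`, so the bound is proved for each `l' > l` and passed to
  -- the limit.
  have key : ∀ l' > l, ‖φ a - ψ a‖ ≤ l' * ε := fun l' hl' => by
    have hpos : 0 < l' := hl.trans_lt hl'
    have h1 := (le_iSup₂ (f := fun (b : A) (_ : IsSelfAdjoint b ∧ T.lip b ≤ 1) =>
      ENNReal.ofReal ‖φ b - ψ b‖) _ ⟨hsa.ofReal_smul l'⁻¹, T.lip_inv_smul_le_one hpos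
        (ha.trans (ENNReal.ofReal_le_ofReal hl'.le))⟩).trans h
    rw [ENNReal.ofReal_le_ofReal_iff hε, map_smul, map_smul, ← smul_sub, norm_smul,
      Complex.norm_real, norm_inv, Real.norm_of_nonneg hpos.le, inv_mul_le_iff₀ hpos] at h1
    exact h1
  exact ge_of_tendsto ((continuous_mul_const ε).continuousWithinAt (s := Set.Ioi l))
    (eventually_mem_nhdsWithin.mono key)

end LipschitzPair

theorem LipschitzTriple.norm_sub_le_mul_specDist {A : Type*} [NonUnitalCStarAlgebra A]
    (T : LipschitzTriple A) (χ η : T.Spec) {m : T.M} {l : ℝ} (hl : 0 < l)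
    (hsa : IsSelfAdjoint (m : A)) (hm : T.lip (m : A) ≤ ENNReal.ofReal l) :
    ENNReal.ofReal ‖χ m - η m‖ ≤ ENNReal.ofReal l * T.specDist χ η := by
  have h1 : ENNReal.ofReal ‖χ (((l⁻¹ : ℝ) : ℂ) • m) - η (((l⁻¹ : ℝ) : ℂ) • m)‖ ≤
      T.specDist χ η :=
    le_iSup₂ (f := fun (b : T.M) (_ : IsSelfAdjoint (b : A) ∧ T.lip (b : A) ≤ 1) =>
      ENNReal.ofReal ‖χ b - η b‖) _ ⟨hsa.ofReal_smul l⁻¹, T.lip_inv_smul_le_one hl hm⟩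
  rw [map_smul, map_smul, ← smul_sub, norm_smul, Complex.norm_real, norm_inv,
    Real.norm_of_nonneg hl.le, ENNReal.ofReal_mul (inv_pos.2 hl).le] at h1
  calc ENNReal.ofReal ‖χ m - η m‖
      = ENNReal.ofReal l * (ENNReal.ofReal l⁻¹ * ENNReal.ofReal ‖χ m - η m‖) := by
        rw [← mul_assoc, ← ENNReal.ofReal_mul hl.le, mul_inv_cancel₀ hl.ne', ENNReal.ofReal_one,
          one_mul]
    _ ≤ _ := mul_le_mul_right h1 _

/-- A map into the character space is continuous if its evaluations at a set of elements
approximating the self-adjoint ones are. -/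
theorem continuous_characterSpace_of_dense {S M : Type*} [TopologicalSpace S]
    [NonUnitalCStarAlgebra M] {i : S → WeakDual.characterSpace ℂ M} {Q : Set M}
    (hQ : {m | IsSelfAdjoint m} ⊆ closure Q) (hi : ∀ m ∈ Q, Continuous fun s => i s m) :
    Continuous i := by
  have hsa : ∀ m, IsSelfAdjoint m → Continuous fun s => i s m := fun m hm => by
    -- Characters are contractive, so evaluation at `m` is a uniform limit of evaluations at
    -- elements of `Q`.
    refine continuous_of_uniform_approx_of_continuous fun u hu => ?_
    obtain ⟨δ, hδ, hu⟩ := Metric.mem_uniformity_dist.1 hu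
    obtain ⟨q, hq, hd⟩ := Metric.mem_closure_iff.1 (hQ hm) δ hδ
    refine ⟨_, hi q hq, fun s => hu ?_⟩
    rw [dist_eq_norm, ← map_sub]
    rw [dist_eq_norm] at hd
    exact (norm_character_apply_le _ _).trans_lt hd
  refine continuous_induced_rng.2 (WeakDual.continuous_of_continuous_eval fun m => ?_)
  have h : (fun s => i s m) =
      fun s => i s (realPart m : M) + Complex.I * i s (imaginaryPart m : M) := by
    ext s
    rw [← smul_eq_mul, ← map_smul, ← map_add, realPart_add_I_smul_imaginaryPart]
  change Continuous fun s => i s m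
  rw [h]
  exact (hsa _ (realPart m).2).add (continuous_const.mul (hsa _ (imaginaryPart m).2))

/-- Properness gives compactness for the metric topology, and the indicator net needs weak*
compactness. It suffices that the identity be continuous from the former topology to the latter:
evaluations at Lipschitz elements of `M` are Lipschitz, and these elements are dense in the
self-adjoint part of `M`. -/
theorem LipschitzTriple.IsProperQuantum.isCompact_specBall {A : Type*} [NonUnitalCStarAlgebra A]
    [PartialOrder A] [StarOrderedRing A] {T : LipschitzTriple A} (hT : T.IsProperQuantum)
    (μ : T.Spec) (R : ℝ) : IsCompact (T.specBall μ R) := by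
  have hcl : IsClosed (T.M : Set A) := T.topography.isClosed
  obtain ⟨m, hm, hp⟩ := hT.proper
  let t : TopologicalSpace T.Spec := m.toPseudoMetricSpace.toUniformSpace.toTopologicalSpace
  have hball : @IsCompact T.Spec t (T.specBall μ R) := by
    -- `ENNReal.ofReal` sends negative radii to `0`, whence the `max`.
    have h1 : T.specBall μ R = @Metric.closedBall T.Spec m.toPseudoMetricSpace μ (max R 0) := by
      ext χ
      rw [← @Metric.closedEBall_ofReal T.Spec m.toPseudoMetricSpace _ _ (le_max_right R 0)]
      change T.specDist χ μ ≤ _ ↔ m.edist χ μ ≤ _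
      rw [hm, ENNReal.ofReal_max, ENNReal.ofReal_zero, max_eq_left zero_le]
    rw [h1]
    exact @isCompact_closedBall T.Spec m.toPseudoMetricSpace hp μ _
  have hid : @Continuous T.Spec T.Spec t instTopologicalSpaceSubtype id := by
    refine @continuous_characterSpace_of_dense T.Spec T.M t _ id
      {q | IsSelfAdjoint (q : A) ∧ T.lip (q : A) < ⊤} ?_ ?_
    · intro q hq
      rw [closure_subtype]
      refine closure_mono ?_ (hT.dense_topography
        (a := (q : A)) ⟨congrArg Subtype.val hq, q.2⟩)
      rintro a ⟨ha, haM⟩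
      obtain ⟨K, hK⟩ := Set.mem_iUnion.1 ha
      exact ⟨⟨a, haM⟩, ⟨hK.1.1, hK.2⟩, rfl⟩
    · rintro q ⟨hsa, hlip⟩
      refine (@LipschitzWith.continuous T.Spec ℂ m.toPseudoMetricSpace.toPseudoEMetricSpace _
        -- Adding `1` keeps the constant positive even if `q` has seminorm `0`.
        ((T.lip (q : A)).toReal + 1).toNNReal _ fun χ η => ?_)
      have h1 : T.lip (q : A) ≤ ENNReal.ofReal ((T.lip (q : A)).toReal + 1) := by
        rw [ENNReal.ofReal_add ENNReal.toReal_nonneg zero_le_one, ENNReal.ofReal_toReal hlip.ne]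
        exact le_self_add
      have h2 := T.norm_sub_le_mul_specDist χ η (by positivity) hsa h1
      rw [edist_dist, dist_eq_norm]
      refine h2.trans_eq ?_
      rw [← hm]
      rfl
  have h2 := @IsCompact.image T.Spec T.Spec t instTopologicalSpaceSubtype _ _ hball hid
  rwa [Set.image_id] at h2

/-! ### Lift sets and target sets -/

namespace LipschitzTriple

variable {A : Type*} [NonUnitalCStarAlgebra A] [PartialOrder A] [StarOrderedRing A]

theorem add_smul_mem_lipLoc (T : LipschitzTriple A) {K : Set T.Spec} (hK : IsCompact K) {a b : A}
    (ha : a ∈ T.lipLoc K) (hb : b ∈ T.lipLoc K) (t : ℝ) : a + (t : ℂ) • b ∈ T.lipLoc K := by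
  refine ⟨T.topography.add_smul_mem_localSA hK ha.1 hb.1 t, (T.lip_add_le _ _).trans_lt ?_⟩
  rw [T.lip_smul]
  exact ENNReal.add_lt_top.2 ⟨ha.2, ENNReal.mul_lt_top ENNReal.ofReal_lt_top hb.2⟩

theorem IsProperQuantum.jordanProd_mem_lipLoc {T : LipschitzTriple A} (hT : T.IsProperQuantum)
    {K : Set T.Spec} (hK : IsCompact K) {a b : A} (ha : a ∈ T.lipLoc K) (hb : b ∈ T.lipLoc K) :
    jordanProd a b ∈ T.lipLoc K :=
  ⟨T.topography.jordanProd_mem_localSA hK ha.1 hb.1,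
    (hT.leibniz a b ha.1.1 hb.1.1).1.trans_lt (ENNReal.add_lt_top.2
      ⟨ENNReal.mul_lt_top ENNReal.ofReal_lt_top hb.2,
        ENNReal.mul_lt_top ha.2 ENNReal.ofReal_lt_top⟩)⟩

theorem IsProperQuantum.lieProd_mem_lipLoc {T : LipschitzTriple A} (hT : T.IsProperQuantum)
    {K : Set T.Spec} (hK : IsCompact K) {a b : A} (ha : a ∈ T.lipLoc K) (hb : b ∈ T.lipLoc K) :
    lieProd a b ∈ T.lipLoc K :=
  ⟨T.topography.lieProd_mem_localSA hK ha.1 hb.1,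
    (hT.leibniz a b ha.1.1 hb.1.1).2.trans_lt (ENNReal.add_lt_top.2
      ⟨ENNReal.mul_lt_top ENNReal.ofReal_lt_top hb.2,
        ENNReal.mul_lt_top ha.2 ENNReal.ofReal_lt_top⟩)⟩

end LipschitzTriple

theorem map_jordanProd {A B : Type*} [NonUnitalCStarAlgebra A] [NonUnitalCStarAlgebra B]
    (π : A →⋆ₙₐ[ℂ] B) (a b : A) : π (jordanProd a b) = jordanProd (π a) (π b) := by
  simp only [jordanProd, map_smul, map_add, map_mul]

theorem map_lieProd {A B : Type*} [NonUnitalCStarAlgebra A] [NonUnitalCStarAlgebra B]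
    (π : A →⋆ₙₐ[ℂ] B) (a b : A) : π (lieProd a b) = lieProd (π a) (π b) := by
  simp only [lieProd, map_smul, map_sub, map_mul]

namespace Passage

variable {A B D : Type*} [NonUnitalCStarAlgebra A] [PartialOrder A] [StarOrderedRing A]
  [NonUnitalCStarAlgebra B] [PartialOrder B] [StarOrderedRing B]
  [NonUnitalCStarAlgebra D] [PartialOrder D] [StarOrderedRing D]
  {X : PointedProperQMS A} {Y : PointedProperQMS B} {τ : Passage X Y D}
  {l r ε : ℝ} {K : TopologicalSpace.Compacts τ.Spec} {a a' : A} {d d' : D}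

/-- A state norming `d` or `-d` is supported on `K`, hence is `ε`-close to some `ψ ∘ π_A`, whose
value at `d` is `ψ(a)`. -/
theorem norm_le_of_mem_liftSet (hK : τ.IsLeftAdmissible r ε K) (hl : 0 ≤ l)
    (hd : d ∈ τ.liftSet a l r ε K) : ‖d‖ ≤ ‖a‖ + l * ε := by
  obtain ⟨⟨hloc, -⟩, rfl, -, hlip⟩ := hd
  -- A state attaining the norm of `0` carries no information on its support, so this case is
  -- separate.
  rcases eq_or_ne d 0 with rfl | h0
  · rw [norm_zero]
    have := hK.pos
    positivity
  have hφ : ∃ φ ∈ localStates τ.M K, ‖φ d‖ = ‖d‖ := by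
    obtain ⟨φ, hφ, h | h⟩ := exists_state_norm_apply_eq hloc.1 h0
    · exact ⟨φ, τ.topography.mem_localStates K.isCompact hφ hloc h0 h, by simp [h]⟩
    · have hneg : -d ∈ localSA τ.M K := by
        rw [τ.topography.mem_localSA_iff K.isCompact] at hloc ⊢
        refine ⟨hloc.1.neg, fun m hm => ?_⟩
        rw [mul_neg, neg_mul, (hloc.2 m hm).1, (hloc.2 m hm).2]
        exact ⟨rfl, rfl⟩
      refine ⟨φ, τ.topography.mem_localStates K.isCompact hφ hneg (neg_ne_zero.2 h0)
        (by rw [h, norm_neg]), ?_⟩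
      rw [← norm_neg (φ d), ← map_neg, h, Complex.norm_real, norm_norm]
  obtain ⟨φ, hφ, hφd⟩ := hφ
  obtain ⟨ψ, hψ, hmk⟩ := hK.state_almost_subset φ hφ
  have h1 := τ.norm_sub_le_of_mkDist_le hl hK.pos.le hloc.1 hlip hmk
  have h2 : ‖pullback τ.πA ψ d‖ ≤ ‖τ.πA d‖ :=
    (ψ.le_opNorm (τ.πA d)).trans_eq (by rw [hψ.1.1, one_mul])
  have h3 := norm_sub_norm_le (φ d) (pullback τ.πA ψ d)
  linarith

theorem add_smul_mem_liftSet (hd : d ∈ τ.liftSet a l r ε K) (hd' : d' ∈ τ.liftSet a' l r ε K)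
    (hl : 0 ≤ l) (t : ℝ) :
    d + (t : ℂ) • d' ∈ τ.liftSet (a + (t : ℂ) • a') ((1 + |t|) * l) r ε K := by
  obtain ⟨hloc, rfl, hB, hlip⟩ := hd
  obtain ⟨hloc', rfl, hB', hlip'⟩ := hd'
  refine ⟨τ.add_smul_mem_lipLoc K.isCompact hloc hloc' t, by rw [map_add, map_smul], ?_, ?_⟩
  · rw [map_add, map_smul]
    exact Y.add_smul_mem_lipLoc (Y.isProper.isCompact_specBall _ _) hB hB' t
  · refine (τ.lip_add_le _ _).trans ?_
    rw [τ.lip_smul, add_mul, one_mul, ENNReal.ofReal_add hl (by positivity),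
      ENNReal.ofReal_mul (abs_nonneg t)]
    gcongr

/-- The constant is `l(y + lε) + l(x + lε)`; it is applied with `x` and `y` the norms of the lifted
elements. -/
theorem leibniz_bound (hl : 0 ≤ l) {u v : D} {x y : ℝ} (hu : τ.lip u ≤ ENNReal.ofReal l)
    (hv : τ.lip v ≤ ENNReal.ofReal l) (hx : ‖u‖ ≤ x + l * ε) (hy : ‖v‖ ≤ y + l * ε) :
    τ.lip u * ENNReal.ofReal ‖v‖ + τ.lip v * ENNReal.ofReal ‖u‖ ≤
      ENNReal.ofReal (l * (x + y + 2 * l * ε)) := by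
  have h1 : l * (x + y + 2 * l * ε) = l * (y + l * ε) + l * (x + l * ε) := by ring
  have hx0 := (norm_nonneg u).trans hx
  have hy0 := (norm_nonneg v).trans hy
  rw [h1, ENNReal.ofReal_add (mul_nonneg hl hy0) (mul_nonneg hl hx0), ENNReal.ofReal_mul hl,
    ENNReal.ofReal_mul hl]
  gcongr

/-- The quantitative bound comes from the Leibniz inequality for `L_D` on the corner of `K`. In `B`
only finiteness of the seminorm is needed, and the Leibniz property of `L_B` provides it. -/
theorem jordanProd_mem_liftSet (hK : τ.IsAdmissiblePair r ε K) (hl : 0 ≤ l)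
    (hd : d ∈ τ.liftSet a l r ε K) (hd' : d' ∈ τ.liftSet a' l r ε K) :
    jordanProd d d' ∈ τ.liftSet (jordanProd a a') (l * (‖a‖ + ‖a'‖ + 2 * l * ε)) r ε K := by
  have hn := norm_le_of_mem_liftSet hK.left hl hd
  have hn' := norm_le_of_mem_liftSet hK.left hl hd'
  obtain ⟨hloc, rfl, hB, hlip⟩ := hd
  obtain ⟨hloc', rfl, hB', hlip'⟩ := hd'
  have hL := (hK.jordan d hloc d' hloc').trans (leibniz_bound hl hlip hlip' hn hn')
  refine ⟨⟨τ.topography.jordanProd_mem_localSA K.isCompact hloc.1 hloc'.1,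
    hL.trans_lt ENNReal.ofReal_lt_top⟩, map_jordanProd _ _ _, ?_, hL⟩
  rw [map_jordanProd]
  exact Y.isProper.jordanProd_mem_lipLoc (Y.isProper.isCompact_specBall _ _) hB hB'

theorem lieProd_mem_liftSet (hK : τ.IsAdmissiblePair r ε K) (hl : 0 ≤ l)
    (hd : d ∈ τ.liftSet a l r ε K) (hd' : d' ∈ τ.liftSet a' l r ε K) :
    lieProd d d' ∈ τ.liftSet (lieProd a a') (l * (‖a‖ + ‖a'‖ + 2 * l * ε)) r ε K := by
  have hn := norm_le_of_mem_liftSet hK.left hl hd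
  have hn' := norm_le_of_mem_liftSet hK.left hl hd'
  obtain ⟨hloc, rfl, hB, hlip⟩ := hd
  obtain ⟨hloc', rfl, hB', hlip'⟩ := hd'
  have hL := (hK.lie d hloc d' hloc').trans (leibniz_bound hl hlip hlip' hn hn')
  refine ⟨⟨τ.topography.lieProd_mem_localSA K.isCompact hloc.1 hloc'.1,
    hL.trans_lt ENNReal.ofReal_lt_top⟩, map_lieProd _ _ _, ?_, hL⟩
  rw [map_lieProd]
  exact Y.isProper.lieProd_mem_lipLoc (Y.isProper.isCompact_specBall _ _) hB hB'

theorem norm_le_of_mem_targetSet (hK : τ.IsLeftAdmissible r ε K) (hl : 0 ≤ l) {b : B}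
    (hb : b ∈ τ.targetSet a l r ε K) : ‖b‖ ≤ ‖a‖ + l * ε := by
  obtain ⟨d, hd, rfl⟩ := hb
  exact (NonUnitalStarAlgHom.norm_apply_le τ.πB d).trans (norm_le_of_mem_liftSet hK hl hd)

theorem add_smul_mem_targetSet {b b' : B} (hb : b ∈ τ.targetSet a l r ε K)
    (hb' : b' ∈ τ.targetSet a' l r ε K) (hl : 0 ≤ l) (t : ℝ) :
    b + (t : ℂ) • b' ∈ τ.targetSet (a + (t : ℂ) • a') ((1 + |t|) * l) r ε K := by
  obtain ⟨d, hd, rfl⟩ := hb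
  obtain ⟨d', hd', rfl⟩ := hb'
  exact ⟨_, add_smul_mem_liftSet hd hd' hl t, by rw [map_add, map_smul]⟩

/-- By linearity with `t = -1`, `b - b'` is a target of `a - a'` for the constant `2l`, so the norm
bound applies to it. -/
theorem norm_sub_le_of_mem_targetSet (hK : τ.IsLeftAdmissible r ε K) (hl : 0 ≤ l) {b b' : B}
    (hb : b ∈ τ.targetSet a l r ε K) (hb' : b' ∈ τ.targetSet a' l r ε K) :
    ‖b - b'‖ ≤ ‖a - a'‖ + 2 * l * ε := by
  have h := norm_le_of_mem_targetSet hK (by positivity) (add_smul_mem_targetSet hb hb' hl (-1))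
  have h1 : 1 + |(-1 : ℝ)| = 2 := by norm_num
  rw [h1] at h
  simpa [← sub_eq_add_neg] using h

end Passage

theorem mainTheorem4 {A B D : Type*}
    [NonUnitalCStarAlgebra A] [PartialOrder A] [StarOrderedRing A]
    [NonUnitalCStarAlgebra B] [PartialOrder B] [StarOrderedRing B]
    [NonUnitalCStarAlgebra D] [PartialOrder D] [StarOrderedRing D]
    (X : PointedProperQMS A) (Y : PointedProperQMS B) (τ : Passage X Y D)
    (r : ℝ) (hr : 0 < r) (hτ : τ.IsTunnel r) (l : ℝ) (hl : 0 ≤ l)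
    (ε : ℝ) (K : TopologicalSpace.Compacts τ.Spec) (hK : τ.IsAdmissiblePair r ε K) :
    (∀ a ∈ X.lipBall r, X.lip a ≤ ENNReal.ofReal l →
      (∀ d ∈ τ.liftSet a l r ε K, ‖d‖ ≤ ‖a‖ + l * ε) ∧
      (∀ b ∈ τ.targetSet a l r ε K, ‖b‖ ≤ ‖a‖ + l * ε)) ∧
    (∀ a ∈ X.lipBall r, ∀ a' ∈ X.lipBall r,
      X.lip a ≤ ENNReal.ofReal l → X.lip a' ≤ ENNReal.ofReal l →
      ∀ b ∈ τ.targetSet a l r ε K, ∀ b' ∈ τ.targetSet a' l r ε K, ∀ t : ℝ,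
        b + (t : ℂ) • b' ∈ τ.targetSet (a + (t : ℂ) • a') ((1 + |t|) * l) r ε K) ∧
    (∀ a ∈ X.lipBall r, ∀ a' ∈ X.lipBall r,
      X.lip a ≤ ENNReal.ofReal l → X.lip a' ≤ ENNReal.ofReal l →
      (⨆ (b : B) (_ : b ∈ τ.targetSet a l r ε K) (b' : B) (_ : b' ∈ τ.targetSet a' l r ε K),
        ENNReal.ofReal ‖b - b'‖) ≤ ENNReal.ofReal (‖a - a'‖ + 2 * l * ε)) ∧
    (∀ a ∈ X.lipBall r, X.lip a ≤ ENNReal.ofReal l →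
      Metric.ediam (τ.targetSet a l r ε K) ≤ ENNReal.ofReal (2 * l * ε)) ∧
    (∀ a ∈ X.lipBall r, ∀ a' ∈ X.lipBall r,
      X.lip a ≤ ENNReal.ofReal l → X.lip a' ≤ ENNReal.ofReal l →
      ∀ b ∈ τ.targetSet a l r ε K, ∀ b' ∈ τ.targetSet a' l r ε K,
        jordanProd b b' ∈
          τ.targetSet (jordanProd a a') (l * (‖a‖ + ‖a'‖ + 2 * l * ε)) r ε K ∧
        lieProd b b' ∈
          τ.targetSet (lieProd a a') (l * (‖a‖ + ‖a'‖ + 2 * l * ε)) r ε K) := by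
  refine ⟨fun a _ _ => ⟨fun d hd => Passage.norm_le_of_mem_liftSet hK.left hl hd,
      fun b hb => Passage.norm_le_of_mem_targetSet hK.left hl hb⟩,
    fun a _ a' _ _ _ b hb b' hb' t => Passage.add_smul_mem_targetSet hb hb' hl t,
    fun a _ a' _ _ _ => iSup₂_le fun b hb => iSup₂_le fun b' hb' => ENNReal.ofReal_le_ofReal
      (Passage.norm_sub_le_of_mem_targetSet hK.left hl hb hb'),
    fun a _ _ => Metric.ediam_le fun b hb b' hb' => ?_,
    fun a _ a' _ _ _ b hb b' hb' => ?_⟩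
  · rw [edist_dist, dist_eq_norm]
    have h := Passage.norm_sub_le_of_mem_targetSet hK.left hl hb hb'
    rw [sub_self, norm_zero, zero_add] at h
    exact ENNReal.ofReal_le_ofReal h
  · obtain ⟨d, hd, rfl⟩ := hb
    obtain ⟨d', hd', rfl⟩ := hb'
    exact ⟨⟨_, Passage.jordanProd_mem_liftSet hK hl hd hd', map_jordanProd _ _ _⟩,
      ⟨_, Passage.lieProd_mem_liftSet hK hl hd hd', map_lieProd _ _ _⟩⟩
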